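/- For a sequence $c=[c_1,\dots,c_m]$ of odd length of nonzero even integers, let $K(c)$ be the oriented 2-bridge link of two components whose type is the rational number with even continued fraction expansion $$[c_1,\dots,c_m]=\cfrac{1}{c_1-\cfrac{1}{c_2-\cfrac{1}{\ddots-\cfrac{1}{c_m}}}}\,.$$ It is given by its standard diagram: four horizontal strings, numbered from top to bottom, where, from left to right, the two middle strings are given $c_1$ half twists, the two upper strings $c_2$ half twists, the two middle strings $c_3$ half twists, and so on (right-handed half twists for $c_i>0$, left-handed ones for $c_i<0$), and where at both ends the first string is joined to the second and the third to the fourth; the components are oriented so that the strings run alternately from left to right and from right to left. Let $\Delta_{K(c)}(x,y)\in\mathbb Z[x^{\pm1},y^{\pm1}]$ be its two-variable Alexander polynomial, that is, the greatest common divisor of the first elementary ideal of the link group, where $x,y$ are the classes of the meridians of the two components; it is defined up to multiplication by units $\pm x^iy^j$. Call $K(c)$ $\mathcal H$-stable if $\Delta_{K(c)}$ is identically zero or $\Delta_{K(c)}(\alpha,\beta)\neq0$ for all $\alpha,\beta$ in the open upper half-plane $\mathcal H=\{z\in\mathbb C:\operatorname{Im} z>0\}$. **Theorem.** Let $n\ge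 0$ and let $s=[2a_1,2b_1,2a_2,2b_2,\dots,2a_n,2b_n,2a_{n+1}]$ with all $a_j,b_j$ nonzero integers. Let $k\neq0$ be an integer and let $r=[s,2k,-s^{-1}]$, where $-s^{-1}=[-2a_{n+1},-2b_n,-2a_n,\dots,-2b_1,-2a_1]$ is $s$ reversed with all signs changed. Then, up to multiplication by a unit $\pm x^iy^j$, $$\Delta_{K(r)}(x,y)=k\,(x-1)(y-1)\,[\Delta_{K(s)}(x,y)]^2 ,$$ and hence $K(r)$ is $\mathcal H$-stable if and only if $K(s)$ is $\mathcal H$-stable. -/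

import Mathlib

noncomputable section

namespace TwoBridge

open LaurentPolynomial (T C)

/-! ### Fox calculus and the Alexander ideal of a group presentation -/

section Fox

variable {E A : Type} [CommRing A]

/-- The action of the free group on `E` by affine maps of the free module `E → A`, for the
homomorphism to `Aˣ` that sends the generator `e` to `t e`: the generator `e` acts by
`m ↦ (basis vector of e) + t e • m`, and so a word `w` acts by `m ↦ D w + t w • m`, where `D` is the
(abelianised) Fox derivation, `D (v w) = D v + t v • D w`, `D e = ` the basis vector of `e`. -/
def foxAction [DecidableEq E] (t : E → Aˣ) : FreeGroup E →* Equiv.Perm (E → A) :=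
  FreeGroup.lift fun e => (MulAction.toPerm (t e)).trans (Equiv.addLeft (Pi.single e 1))

/-- The image in `A` of the Fox derivative `∂w/∂e`. -/
def foxDeriv [DecidableEq E] (t : E → Aˣ) (w : FreeGroup E) (e : E) : A :=
  foxAction t w 0 e

theorem foxDeriv_of [DecidableEq E] (t : E → Aˣ) (a e : E) :
    foxDeriv t (FreeGroup.of a) e = if e = a then 1 else 0 := by
  simp [foxDeriv, foxAction, Pi.single_apply]

theorem foxAction_apply [DecidableEq E] (t : E → Aˣ) (w : FreeGroup E) (m : E → A) :
    foxAction t w m = foxDeriv t w + FreeGroup.lift t w • m := by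
  suffices h : ∀ (w : FreeGroup E) (m m' : E → A),
      foxAction t w m - foxAction t w m' = FreeGroup.lift t w • (m - m') by
    have := h w m 0
    rw [sub_zero, sub_eq_iff_eq_add] at this
    rw [this, add_comm]; rfl
  intro w
  induction w using FreeGroup.induction_on with
  | C1 => simp
  | of a => intro m m'; simp [foxAction, smul_sub]
  | inv_of a ih =>
    intro m m'
    have := ih (foxAction t (FreeGroup.of a)⁻¹ m) (foxAction t (FreeGroup.of a)⁻¹ m')
    simp only [← Equiv.Perm.mul_apply, ← map_mul, mul_inv_cancel, map_one,
      Equiv.Perm.one_apply] at this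
    rw [this, map_inv, map_inv, inv_smul_smul]
  | mul v w hv hw =>
    intro m m'
    rw [map_mul, map_mul, Equiv.Perm.mul_apply, Equiv.Perm.mul_apply, hv, hw, mul_smul]

theorem foxDeriv_mul [DecidableEq E] (t : E → Aˣ) (v w : FreeGroup E) :
    foxDeriv t (v * w) = foxDeriv t v + FreeGroup.lift t v • foxDeriv t w := by
  rw [← foxAction_apply]
  funext e
  rw [foxDeriv, map_mul]
  rfl

/-- The first elementary ideal (Alexander ideal) of the presentation `⟨E | rels⟩`: the ideal
generated by all minors of order `|E| - 1` of the Alexander matrix `(∂r/∂e)`, whose rows are indexed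
by the relators `r` and whose columns are indexed by the generators `e`. -/
def alexanderIdeal [DecidableEq E] [Fintype E] (rels : Set (FreeGroup E)) (t : E → Aˣ) : Ideal A :=
  Ideal.span {d | ∃ (r : Fin (Fintype.card E - 1) → FreeGroup E)
    (e : Fin (Fintype.card E - 1) → E), (∀ i, r i ∈ rels) ∧
      d = (Matrix.of fun i j => foxDeriv t (r i) (e j)).det}

/-- `d` is a greatest common divisor of the elements of the ideal `I`. -/
def IsIdealGCD (I : Ideal A) (d : A) : Prop :=
  ∀ e, e ∣ d ↔ ∀ a ∈ I, e ∣ a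

end Fox

/-! ### Laurent polynomials in two variables -/

/-- The ring `ℤ[x^{±1}, y^{±1}]`. -/
abbrev Laurent2 : Type := LaurentPolynomial (LaurentPolynomial ℤ)

/-- The variable `x`. -/
def X : Laurent2 := C (T 1)

/-- The variable `y`. -/
def Y : Laurent2 := T 1

/-- The variables `x`, `y` as units; they are the classes of the meridians of the first and of the
second component. -/
def meridian : Fin 2 → Laurent2ˣ :=
  ![⟨X, C (T (-1)), by rw [X, ← map_mul, ← LaurentPolynomial.T_add]; simp,
      by rw [X, ← map_mul, ← LaurentPolynomial.T_add]; simp⟩,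
    ⟨Y, T (-1), by rw [Y, ← LaurentPolynomial.T_add]; simp,
      by rw [Y, ← LaurentPolynomial.T_add]; simp⟩]

/-- The value of a Laurent polynomial at `x = α`, `y = β`. -/
def evalAt (α β : ℂˣ) : Laurent2 →+* ℂ :=
  LaurentPolynomial.eval₂ (LaurentPolynomial.eval₂ (Int.castRingHom ℂ) α) β

/-- `f` is stable with respect to the open upper half-plane: it vanishes identically, or it has no
zero `(α, β)` with both `α` and `β` in the upper half-plane. -/
def HStable (f : Laurent2) : Prop :=
  f = 0 ∨ ∀ α β : ℂˣ, 0 < (α : ℂ).im → 0 < (β : ℂ).im → evalAt α β f ≠ 0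

instance laurent_ufm (R : Type) [CommRing R] [IsDomain R] [UniqueFactorizationMonoid R] :
    UniqueFactorizationMonoid (LaurentPolynomial R) :=
  UniqueFactorizationMonoid.of_isLocalization
    (Submonoid.powers (Polynomial.X : Polynomial R)) (LaurentPolynomial R)

theorem exists_isIdealGCD (I : Ideal Laurent2) : ∃ d, IsIdealGCD I d := by
  classical
  have : IsNoetherianRing (LaurentPolynomial ℤ) :=
    IsLocalization.isNoetherianRing (Submonoid.powers (Polynomial.X : Polynomial ℤ)) _ inferInstance
  have hN : IsNoetherianRing Laurent2 :=
    IsLocalization.isNoetherianRing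
      (Submonoid.powers (Polynomial.X : Polynomial (LaurentPolynomial ℤ))) _ inferInstance
  let _ : NormalizedGCDMonoid Laurent2 :=
    Classical.choice inferInstance
  obtain ⟨S, hS⟩ := (isNoetherianRing_iff_ideal_fg Laurent2).1 hN I
  refine ⟨S.gcd id, fun e => ?_⟩
  rw [Finset.dvd_gcd_iff]
  constructor
  · intro h a ha
    rw [← hS] at ha
    have : Ideal.span (S : Set Laurent2) ≤ Ideal.span {e} := by
      rw [Ideal.span_le]
      intro b hb
      exact Ideal.mem_span_singleton.2 (h b hb)
    exact Ideal.mem_span_singleton.1 (this ha)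
  · intro h b hb
    exact h b (hS ▸ Ideal.subset_span hb)

/-! ### Oriented link diagrams and their Alexander polynomials -/

/-- The data at a crossing of an oriented diagram: a piece of the over-crossing strand, and the two
pieces of the under-crossing strand that end at the crossing, one to the left and one to the right
of the (oriented) over-crossing strand. -/
structure Crossing (E : Type) where
  overPiece : E
  leftPiece : E
  rightPiece : E

/-- An oriented diagram of a 2-component link, cut into finitely many pieces `e : E` at the
crossings and at further points of the diagram. -/
structure LinkDiagram (E : Type) where
  /-- the crossings -/
  crossings : Set (Crossing E)
  /-- the pairs of pieces that are adjacent along a strand, other than at an under-crossing -/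
  joins : Set (E × E)
  /-- the component of the link to which a piece belongs -/
  component : E → Fin 2

/-- The relators of the Wirtinger presentation of the link group, with one generator (a meridian)
for every piece of the diagram. -/
def LinkDiagram.wirtinger {E : Type} (D : LinkDiagram E) : Set (FreeGroup E) :=
  {r | ∃ c ∈ D.crossings, r = FreeGroup.of c.overPiece * FreeGroup.of c.rightPiece *
      (FreeGroup.of c.overPiece)⁻¹ * (FreeGroup.of c.leftPiece)⁻¹} ∪
  {r | ∃ p ∈ D.joins, r = FreeGroup.of p.1 * (FreeGroup.of p.2)⁻¹}

/-- The two-variable Alexander polynomial of the link with diagram `D`: the greatest common divisor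
of the first elementary ideal of the link group, over the group ring `ℤ[x^{±1}, y^{±1}]` of the
first homology of the complement. It is determined up to a unit `± x^i y^j`. -/
def LinkDiagram.alexander {E : Type} [DecidableEq E] [Fintype E] (D : LinkDiagram E) : Laurent2 :=
  Classical.choose
    (exists_isIdealGCD (alexanderIdeal D.wirtinger fun e => meridian (D.component e)))

theorem LinkDiagram.isIdealGCD_alexander {E : Type} [DecidableEq E] [Fintype E]
    (D : LinkDiagram E) :
    IsIdealGCD (alexanderIdeal D.wirtinger fun e => meridian (D.component e)) D.alexander :=
  Classical.choose_spec
    (exists_isIdealGCD (alexanderIdeal D.wirtinger fun e => meridian (D.component e)))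

/-! ### The standard diagram of a 2-bridge link

Four strings run horizontally through the levels `0, 1, …, N`; the positions `0, 1, 2, 3` are
numbered from top to bottom. Between two consecutive levels there is one crossing, of the strings
in two neighbouring positions. At both ends, position `0` is joined to position `1` and position `2`
to position `3`. -/

/-- A crossing of a 4-string braid: `(j, true)` is a crossing of the strings in positions `j` and
`j + 1` where the string that runs from `j` (on the left) down to `j + 1` (on the right) is the
over-crossing one, and `(j, false)` is the crossing where the other string is. So `(j, true)` is a
right-handed and `(j, false)` is a left-handed half twist. -/
abbrev Letter : Type := Fin 3 × Bool

/-- The upper of the two positions of a crossing. -/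
def Letter.top (a : Letter) : Fin 4 := a.1.castSucc

/-- The lower of the two positions of a crossing. -/
def Letter.bot (a : Letter) : Fin 4 := a.1.succ

/-- The permutation of the positions effected by a crossing. -/
def Letter.perm (a : Letter) : Equiv.Perm (Fin 4) := Equiv.swap a.top a.bot

/-- The position on the left of the over-crossing string. -/
def Letter.overPos (a : Letter) : Fin 4 := if a.2 then a.top else a.bot

/-- The position on the left of the under-crossing string. -/
def Letter.underPos (a : Letter) : Fin 4 := if a.2 then a.bot else a.top

/-- The braid word of a sequence of twists: for the sequence `c₁, c₂, c₃, …` there are `|c₁|` half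
twists of the two middle strings, `|c₂|` half twists of the two upper strings, `|c₃|` half twists of
the two middle strings and so on, right-handed for `cᵢ > 0` and left-handed for `cᵢ < 0`. The
Boolean is `true` when the next twists are on the middle strings. -/
def twistWord : Bool → List ℤ → List Letter
  | _, [] => []
  | middle, c :: cs =>
      List.replicate c.natAbs ((if middle then 1 else 0 : Fin 3), decide (0 < c)) ++
        twistWord (!middle) cs

/-- `origin w l i` is the position at level `0` of the string that is in position `i` at
level `l`. -/
def origin (w : List Letter) (l : ℕ) : Equiv.Perm (Fin 4) :=
  ((w.take l).map Letter.perm).prod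

/-- The strings that start in positions `0` and `2` run from left to right, the other two from
right to left. -/
def Rightward (w : List Letter) (l : ℕ) (i : Fin 4) : Prop :=
  origin w l i = 0 ∨ origin w l i = 2

instance (w : List Letter) (l : ℕ) (i : Fin 4) : Decidable (Rightward w l i) := by
  unfold Rightward; infer_instance

/-- The pieces of the diagram: `(l, i)` is the piece of string in position `i` at level `l`. -/
abbrev Piece (w : List Letter) : Type := Fin (w.length + 1) × Fin 4

/-- The crossing between the levels `l` and `l + 1`. The end of the under-crossing string on the
side of level `l` is to the right of the over-crossing string if the latter runs rightwards and
descends, or runs leftwards and ascends (from left to right); otherwise it is to the left. -/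
def crossingAt (w : List Letter) (l : Fin w.length) : Crossing (Piece w) :=
  let a := w.get l
  let before : Piece w := (l.castSucc, a.underPos)
  let after : Piece w := (l.succ, a.overPos)
  if a.2 = true ↔ Rightward w l a.overPos then
    { overPiece := (l.castSucc, a.overPos), leftPiece := after, rightPiece := before }
  else
    { overPiece := (l.castSucc, a.overPos), leftPiece := before, rightPiece := after }

/-- The plat closure of a 4-string braid word, with the orientation described above. -/
def platDiagram (w : List Letter) : LinkDiagram (Piece w) where
  crossings := Set.range (crossingAt w)
  joins :=
    {p | ∃ (l : Fin w.length) (i : Fin 4), i ≠ (w.get l).underPos ∧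
      p = ((l.castSucc, i), (l.succ, (w.get l).perm i))} ∪
    {((0, 0), (0, 1)), ((0, 2), (0, 3)),
      ((Fin.last _, 0), (Fin.last _, 1)), ((Fin.last _, 2), (Fin.last _, 3))}
  component := fun p => if (origin w p.1 p.2 : ℕ) < 2 then 0 else 1

/-- The oriented 2-bridge link `K(r)` of type `r = [c₁, …, c_m]`, for a sequence of odd length `m` of
nonzero even integers `cᵢ` (the entries of the even continued fraction expansion of `r`). Since all
`cᵢ` are even, every string begins and ends in the same position, so that the strings in positions
`0`, `1` form one component and those in positions `2`, `3` form the other; in every box of twists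
the two strings run in opposite directions. -/
def twoBridge (c : List ℤ) : LinkDiagram (Piece (twistWord true c)) :=
  platDiagram (twistWord true c)

/-- The Alexander polynomial `Δ_{K(r)}(x, y)`, determined up to units `± x^i y^j`. -/
def Δ (c : List ℤ) : Laurent2 := (twoBridge c).alexander

/-- For a sequence `s`, the sequence `-s⁻¹`, that is, `s` reversed with all signs changed. -/
def negInv (s : List ℤ) : List ℤ := (s.map fun c => -c).reverse

end TwoBridge

end

noncomputable section

namespace TwoBridge

/-! ### Elementary ideals of presentations with a large free part -/

section ElementaryIdeal

variable {A : Type} [CommRing A]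

/-! Write `u l i` for the class of a piece of the diagram in the module presented by the Fox matrix.
Without the closing relations at the right end, this module is free on `u 0 0` and `u 0 2`. The
braid preserves `u₀ - u₁ + u₂ - u₃`, and a full twist acts by `twistMatrix` on the coordinates `u₀ -
u₁` and `δ = (y - 1) u₁ - (x - 1) u₂`; up to sign, `δ` is the Fox derivative of a commutator of two
meridians. The left closure kills the first coordinate, so the right closure imposes the single
relation `M₀₁ δ = 0`, where `M` is the product `braidMatrix` of the twist matrices. Since `x - 1`
and `y - 1` are coprime, the gcd of the elementary ideal is `M₀₁` (`isIdealGCD_platDiagram`,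
`associated_Δ`).

Reversing a sequence and changing its signs inverts its matrix (`braidMatrix_negInv`). So `[s, 2k,
-s⁻¹]` has the matrix `M⁻¹ L M`, where `M` belongs to `s` and `L` is unipotent lower triangular with
corner `-k (x - 1)(y - 1)`. The upper right entry of this conjugate is `k (x - 1)(y - 1) M₀₁² / det
M`, and `det M` is a unit (`inv_mul_lower_mul_apply`). For stability, the extra factors have no
zeros in the upper half-plane. -/

theorem dvd_det_of_mem_span {ι κ E : Type} [Fintype ι] [DecidableEq ι] [Fintype κ] [DecidableEq κ]
    (σ : κ ≃ Option ι) (g : ι → E → A) (v : E → A) (d : A) (r : κ → E → A)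
    (hr : ∀ i, r i ∈ Submodule.span A (insert (d • v) (Set.range g))) (e : κ → E) :
    d ∣ (Matrix.of fun i j => r i (e j)).det := by
  have hex : ∀ i, ∃ (a : A) (c : ι → A), r i = a • d • v + ∑ j, c j • g j := by
    intro i
    obtain ⟨a, z, hz, h⟩ := Submodule.mem_span_insert.1 (hr i)
    obtain ⟨c, hc⟩ := (Submodule.mem_span_range_iff_exists_fun A).1 hz
    exact ⟨a, c, by rw [h, hc]⟩
  choose a c hac using hex
  -- The matrix factors through the generators; `w` scales the row of `v` by `d`, which therefore
  -- comes out of the determinant.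
  let P : Matrix κ κ A := Matrix.of fun i k => (σ k).elim (a i) (c i)
  let R : Matrix κ κ A := Matrix.of fun k j => (σ k).elim (v (e j)) fun l => g l (e j)
  let w : κ → A := fun k => (σ k).elim d fun _ => 1
  have h : (Matrix.of fun i j => r i (e j)) = P * Matrix.of fun k j => w k * R k j := by
    ext i j
    rw [Matrix.mul_apply, ← σ.symm.sum_comp, Fintype.sum_option]
    simp [P, R, w, hac, Finset.sum_apply]
  rw [h, Matrix.det_mul, Matrix.det_mul_column]
  refine Dvd.dvd.mul_left (Dvd.dvd.mul_right ?_ _) _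
  have : d = w (σ.symm none) := by simp [w]
  rw [this]
  exact Finset.dvd_prod_of_mem w (Finset.mem_univ _)

/-- A weak Cauchy–Binet formula: expanding multilinearly in the columns writes the determinant as a
combination of minors. Repeated columns are harmless because `e` ranges over all maps. -/
theorem det_mul_mem {κ E : Type} [Fintype κ] [DecidableEq κ] [Fintype E] [DecidableEq E]
    (I : Ideal A) (R : Matrix κ E A) (h : ∀ e : κ → E, (R.submatrix id e).det ∈ I)
    (F : Matrix E κ A) : (R * F).det ∈ I := by
  have h1 : (R * F).det =
      (Matrix.detRowAlternating (R := A) (n := κ)).toMultilinearMap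
        fun j => ∑ e, F e j • fun i => R i e := by
    rw [← Matrix.det_transpose]
    change Matrix.det _ = Matrix.det _
    congr 1
    ext i j
    simp [Matrix.mul_apply, Finset.sum_apply, mul_comm]
  rw [h1, MultilinearMap.map_sum]
  refine Ideal.sum_mem _ fun e _ => ?_
  rw [MultilinearMap.map_smul_univ, smul_eq_mul]
  refine Ideal.mul_mem_left _ _ ?_
  have := h e
  rw [← Matrix.det_transpose] at this
  exact this

/-- The family `h, p, q` spans and has the right cardinality, so it is a basis. In the dual
coordinates other than that of `q`, the rows `h, ρ` form a block triangular matrix with diagonal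
blocks `1` and `d * a`. -/
theorem mul_mem_of_minors_mem {ι E : Type} [Fintype ι] [DecidableEq ι] [Fintype E] [DecidableEq E]
    (I : Ideal A) (h : ι → E → A) (p q ρ : E → A) (d a b : A)
    (hcard : Fintype.card ι + 2 = Fintype.card E)
    (hspan : ∀ e : E, Pi.single e 1 ∈ Submodule.span A (insert q (insert p (Set.range h))))
    (hρ : ρ - d • (a • p + b • q) ∈ Submodule.span A (Set.range h))
    (hI : ∀ e : ι ⊕ Unit → E, (Matrix.of fun i j => Sum.elim h (fun _ => ρ) i (e j)).det ∈ I) :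
    d * a ∈ I := by
  have hex : ∀ e, ∃ (x y : A) (c : ι → A),
      (Pi.single e 1 : E → A) = x • q + (y • p + ∑ j, c j • h j) := by
    intro e
    obtain ⟨x, z, hz, h1⟩ := Submodule.mem_span_insert.1 (hspan e)
    obtain ⟨y, z', hz', h2⟩ := Submodule.mem_span_insert.1 hz
    obtain ⟨c, hc⟩ := (Submodule.mem_span_range_iff_exists_fun A).1 hz'
    exact ⟨x, y, c, by rw [h1, h2, hc]⟩
  choose x y c hxyc using hex
  let H : Matrix ((ι ⊕ Unit) ⊕ Unit) E A :=
    Matrix.of (Sum.elim (Sum.elim h fun _ => p) fun _ => q)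
  let K : Matrix E ((ι ⊕ Unit) ⊕ Unit) A :=
    Matrix.of fun e => Sum.elim (Sum.elim (c e) fun _ => y e) fun _ => x e
  have hKH : K * H = 1 := by
    ext e f
    have := congrFun (hxyc e) f
    have h1 : (1 : Matrix E E A) e f = (Pi.single e 1 : E → A) f := by
      simp [Matrix.one_apply, Pi.single_apply, eq_comm]
    rw [h1, this, Matrix.mul_apply]
    simp [K, H, Finset.sum_apply]
    ring
  have hHK : H * K = 1 :=
    (Matrix.mul_eq_one_comm_of_card_eq _ _ _ (by simp [← hcard])).1 hKH
  obtain ⟨z, hz⟩ := (Submodule.mem_span_range_iff_exists_fun A).1 hρ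
  have hρ' : ρ = d • (a • p + b • q) + ∑ j, z j • h j := by rw [hz]; abel
  have hent : ∀ i j, ∑ e, H i e * K e j = if i = j then 1 else 0 := by
    intro i j
    rw [← Matrix.one_apply, ← hHK, Matrix.mul_apply]
  have hprod : (Matrix.of (Sum.elim h fun _ : Unit => ρ)) * K.submatrix id Sum.inl =
      Matrix.fromBlocks 1 0 (Matrix.of fun _ j => z j) (Matrix.of fun _ _ => d * a) := by
    have hrow : ∀ i j, ∑ e, h i e * K e j = (if (Sum.inl (Sum.inl i)) = j then 1 else 0) :=
      fun i j => hent (Sum.inl (Sum.inl i)) j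
    have hp : ∀ j, ∑ e, p e * K e j = (if (Sum.inl (Sum.inr ())) = j then 1 else 0) :=
      fun j => hent (Sum.inl (Sum.inr ())) j
    have hq : ∀ j, ∑ e, q e * K e j = (if (Sum.inr ()) = j then 1 else 0) :=
      fun j => hent (Sum.inr ()) j
    have hlast : ∀ j, ∑ e, ρ e * K e j =
        d * a * (if Sum.inl (Sum.inr ()) = j then 1 else 0) +
          d * b * (if Sum.inr () = j then 1 else 0)
          + ∑ i, z i * (if (Sum.inl (Sum.inl i)) = j then 1 else 0) := by
      intro j
      simp_rw [← hrow, ← hp, ← hq, Finset.mul_sum]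
      rw [Finset.sum_comm, ← Finset.sum_add_distrib, ← Finset.sum_add_distrib]
      refine Finset.sum_congr rfl fun e _ => ?_
      rw [hρ']
      simp only [Pi.add_apply, Pi.smul_apply, smul_eq_mul, Finset.sum_apply, add_mul,
        Finset.sum_mul]
      simp only [mul_assoc]
      ring
    ext i j
    rcases i with i | i <;> rcases j with j | j
    · simpa [Matrix.mul_apply, Matrix.one_apply] using hrow i (Sum.inl (Sum.inl j))
    · simpa [Matrix.mul_apply, Matrix.one_apply] using hrow i (Sum.inl (Sum.inr j))
    · simpa [Matrix.mul_apply, Matrix.one_apply] using hlast (Sum.inl (Sum.inl j))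
    · simpa [Matrix.mul_apply, Matrix.one_apply] using hlast (Sum.inl (Sum.inr j))
  have hdet := det_mul_mem I (Matrix.of (Sum.elim h fun _ : Unit => ρ)) hI (K.submatrix id Sum.inl)
  rw [hprod, Matrix.det_fromBlocks_zero₁₂] at hdet
  simpa using hdet

/-- Modulo the `h i` the module is free on `p, q`, and every relation is a multiple of `d • (a • p +
b • q)`. Thus `d` divides all minors, while the ideal contains `d * a` and `d * b`. -/
theorem isIdealGCD_alexanderIdeal {ι E : Type} [Fintype ι] [DecidableEq ι] [Fintype E]
    [DecidableEq E] (rels : Set (FreeGroup E)) (t : E → Aˣ) (h : ι → FreeGroup E)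
    (p q : E → A) (ρ : FreeGroup E) (d a b : A)
    (hcard : Fintype.card ι + 2 = Fintype.card E) (hh : ∀ i, h i ∈ rels) (hρ : ρ ∈ rels)
    (hspan : ∀ e : E, Pi.single e 1 ∈
      Submodule.span A (insert q (insert p (Set.range fun i => foxDeriv t (h i)))))
    (hmod : foxDeriv t ρ - d • (a • p + b • q) ∈
      Submodule.span A (Set.range fun i => foxDeriv t (h i)))
    (hall : ∀ r ∈ rels, foxDeriv t r ∈
      Submodule.span A (insert (d • (a • p + b • q)) (Set.range fun i => foxDeriv t (h i))))
    (hgcd : ∀ e, e ∣ d * a → e ∣ d * b → e ∣ d) :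
    IsIdealGCD (alexanderIdeal rels t) d := by
  have hminor : ∀ e : ι ⊕ Unit → E,
      (Matrix.of fun i j => Sum.elim (fun i => foxDeriv t (h i)) (fun _ => foxDeriv t ρ) i
        (e j)).det ∈ alexanderIdeal rels t := by
    intro e
    have σ : Fin (Fintype.card E - 1) ≃ ι ⊕ Unit :=
      Fintype.equivOfCardEq (by simp; omega)
    rw [← Matrix.det_submatrix_equiv_self σ]
    refine Ideal.subset_span ⟨fun i => Sum.elim h (fun _ => ρ) (σ i), fun j => e (σ j), ?_, ?_⟩
    · intro i
      change Sum.elim h (fun _ => ρ) (σ i) ∈ rels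
      rcases σ i with i | i
      · exact hh i
      · exact hρ
    · congr 1
      ext i j
      simp only [Matrix.submatrix_apply, Matrix.of_apply]
      rcases σ i with i | i <;> rfl
  have ha := mul_mem_of_minors_mem _ _ p q _ d a b hcard hspan hmod hminor
  -- The same argument with the roles of `p` and `q` exchanged.
  have hb := mul_mem_of_minors_mem _ _ q p _ d b a hcard
    (fun e => by rw [Set.insert_comm]; exact hspan e) (by rwa [add_comm]) hminor
  refine fun e => ⟨fun he z hz => ?_, fun he => hgcd e (he _ ha) (he _ hb)⟩
  refine he.trans (Ideal.mem_span_singleton.1 ((Ideal.span_le.2 ?_ :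
    alexanderIdeal rels t ≤ Ideal.span {d}) hz))
  rintro _ ⟨r, f, hr, rfl⟩
  refine Ideal.mem_span_singleton.2 ?_
  exact dvd_det_of_mem_span (Fintype.equivOfCardEq (by simp; omega)) (fun i => foxDeriv t (h i)) _ d
    (fun i => foxDeriv t (r i)) (fun i => hall _ (hr i)) f

theorem IsIdealGCD.associated [IsDomain A] {I : Ideal A} {d d' : A} (h : IsIdealGCD I d)
    (h' : IsIdealGCD I d') : Associated d d' :=
  associated_of_dvd_dvd ((h' d).2 ((h d).1 dvd_rfl)) ((h d').2 ((h' d').1 dvd_rfl))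

theorem foxDeriv_inv {E : Type} [DecidableEq E] (t : E → Aˣ) (w : FreeGroup E) :
    foxDeriv t w⁻¹ = -((FreeGroup.lift t w)⁻¹ • foxDeriv t w) := by
  have h := foxDeriv_mul t w⁻¹ w
  have h1 : foxDeriv t (1 : FreeGroup E) = 0 := by
    have := foxDeriv_mul t 1 1
    simpa using this
  rw [inv_mul_cancel, h1, map_inv] at h
  exact eq_neg_of_add_eq_zero_left h.symm

theorem foxDeriv_of_eq_single {E : Type} [DecidableEq E] (t : E → Aˣ) (e : E) :
    foxDeriv t (FreeGroup.of e) = Pi.single e 1 := by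
  ext f
  rw [foxDeriv_of, Pi.single_apply]

theorem foxDeriv_join {E : Type} [DecidableEq E] (t : E → Aˣ) {e f : E} (h : t e = t f) :
    foxDeriv t (FreeGroup.of e * (FreeGroup.of f)⁻¹) = Pi.single e 1 - Pi.single f 1 := by
  rw [foxDeriv_mul, foxDeriv_inv, foxDeriv_of_eq_single, foxDeriv_of_eq_single]
  simp [h, sub_eq_add_neg]

theorem foxDeriv_conj {E : Type} [DecidableEq E] (t : E → Aˣ) {o r l : E} (h : t r = t l) :
    foxDeriv t (FreeGroup.of o * FreeGroup.of r * (FreeGroup.of o)⁻¹ * (FreeGroup.of l)⁻¹) =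
      (1 - t r : A) • Pi.single o 1 + (t o : A) • Pi.single r 1 - Pi.single l 1 := by
  simp only [foxDeriv_mul, foxDeriv_inv, foxDeriv_of_eq_single, map_mul, map_inv,
    FreeGroup.lift_apply_of, ← h, smul_neg, smul_smul]
  simp only [mul_inv_cancel_comm, mul_inv_cancel, one_smul, sub_smul, Units.smul_def]
  abel

end ElementaryIdeal

/-! ### Laurent polynomials -/

section Laurent

open LaurentPolynomial (T C)

/-- The remainder theorem at `T = 1`; by additivity only monomials matter, with exponents of either
sign. -/
theorem T_one_sub_one_dvd {R : Type} [CommRing R] (f : LaurentPolynomial R) :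
    (T 1 - 1 : LaurentPolynomial R) ∣
      f - C (LaurentPolynomial.eval₂ (RingHom.id R) (1 : Rˣ) f) := by
  have hT : ∀ n : ℤ, (T 1 - 1 : LaurentPolynomial R) ∣ T n - 1 := by
    intro n
    induction n using Int.induction_on with
    | zero => simp [LaurentPolynomial.T_zero]
    | succ n ih =>
      have : (T ((n : ℤ) + 1) - 1 : LaurentPolynomial R) = T 1 * (T n - 1) + (T 1 - 1) := by
        rw [LaurentPolynomial.T_add]; ring
      rw [this]
      exact dvd_add (ih.mul_left _) dvd_rfl
    | pred n ih =>
      have : (T (-(n : ℤ) - 1) - 1 : LaurentPolynomial R) =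
          T (-1) * ((T (-(n : ℤ)) - 1) - (T 1 - 1)) := by
        have h1 : (T (-1) * T 1 : LaurentPolynomial R) = 1 := by
          rw [← LaurentPolynomial.T_add]; simp [LaurentPolynomial.T_zero]
        rw [sub_eq_add_neg (-(n : ℤ)), LaurentPolynomial.T_add]; linear_combination h1
      rw [this]
      exact (dvd_sub ih dvd_rfl).mul_left _
  induction f using LaurentPolynomial.induction_on' with
  | add f g hf hg =>
    rw [map_add, map_add, add_sub_add_comm]
    exact dvd_add hf hg
  | C_mul_T n a =>
    rw [LaurentPolynomial.eval₂_C_mul_T]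
    simp only [RingHom.id_apply, one_zpow, Units.val_one, mul_one]
    rw [← mul_sub_one]
    exact (hT n).mul_left _

theorem X_sub_one_ne_zero : X - 1 ≠ 0 := by
  intro h
  have := congrArg (evalAt (Units.mk0 2 two_ne_zero) 1) h
  norm_num [evalAt, X] at this

theorem Y_sub_one_ne_zero : Y - 1 ≠ 0 := by
  intro h
  have := congrArg (evalAt 1 (Units.mk0 2 two_ne_zero)) h
  norm_num [evalAt, Y] at this

/-- This is the coprimality of `x - 1` and `y - 1`: setting `y = 1` in `s (x - 1) = -u (y - 1)`
shows that `y - 1` divides `s`. -/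
theorem dvd_of_dvd_mul_sub_one {e d : Laurent2} (h1 : e ∣ d * (Y - 1)) (h2 : e ∣ d * -(X - 1)) :
    e ∣ d := by
  obtain ⟨s, hs⟩ := h1
  obtain ⟨u, hu⟩ := h2
  by_cases he : e = 0
  · subst he
    rw [zero_mul] at hs
    rw [(mul_eq_zero.1 hs).resolve_right Y_sub_one_ne_zero]
  have h : s * (X - 1) = -u * (Y - 1) := by
    apply mul_left_cancel₀ he
    linear_combination (X - 1) * -hs - (Y - 1) * hu
  have hev := congrArg (LaurentPolynomial.eval₂ (RingHom.id _) (1 : (LaurentPolynomial ℤ)ˣ)) h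
  simp only [map_mul, map_sub, map_one, X, Y, LaurentPolynomial.eval₂_C, LaurentPolynomial.eval₂_T,
    one_zpow, Units.val_one, sub_self, mul_zero, RingHom.id_apply] at hev
  have hne : (T 1 - 1 : LaurentPolynomial ℤ) ≠ 0 := by
    intro h0
    apply X_sub_one_ne_zero
    rw [X, ← map_one C, ← map_sub, h0, map_zero]
  have hdvd := T_one_sub_one_dvd s
  rw [(mul_eq_zero.1 hev).resolve_right hne, map_zero, sub_zero] at hdvd
  obtain ⟨v, rfl⟩ := hdvd
  refine ⟨v, mul_right_cancel₀ Y_sub_one_ne_zero ?_⟩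
  rw [hs, Y]
  ring

end Laurent

/-! ### Colourings of a plat diagram by elements of a module -/

section Coloring

theorem origin_zero (w : List Letter) : origin w 0 = 1 := by simp [origin]

theorem origin_succ {w : List Letter} {l : ℕ} {a : Letter} (h : w[l]? = some a) :
    origin w (l + 1) = origin w l * a.perm := by
  simp [origin, List.take_add_one, h]

theorem Letter.perm_overPos (a : Letter) : a.perm a.overPos = a.underPos := by
  unfold Letter.perm Letter.overPos Letter.underPos
  split <;> simp

theorem Letter.perm_underPos (a : Letter) : a.perm a.underPos = a.overPos := by
  unfold Letter.perm Letter.overPos Letter.underPos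
  split <;> simp

/-- The meridian of the component through position `i` at level `l`. -/
def meridianAt (w : List Letter) (l : ℕ) (i : Fin 4) : Laurent2ˣ :=
  meridian (if (origin w l i : ℕ) < 2 then 0 else 1)

theorem meridianAt_perm {w : List Letter} {l : ℕ} {a : Letter} (h : w[l]? = some a) (i : Fin 4) :
    meridianAt w (l + 1) (a.perm i) = meridianAt w l i := by
  have : a.perm (a.perm i) = i := by simp [Letter.perm]
  rw [meridianAt, origin_succ h, Equiv.Perm.mul_apply, this, meridianAt]

theorem meridianAt_overPos {w : List Letter} {l : ℕ} {a : Letter} (h : w[l]? = some a) :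
    meridianAt w (l + 1) a.overPos = meridianAt w l a.underPos := by
  rw [← meridianAt_perm h, Letter.perm_underPos]

variable {Q : Type} [AddCommGroup Q] [Module Laurent2 Q]

/-- Elements `u l i` attached to the pieces of the plat diagram of `w` and satisfying the Fox
linearisations of the relations at the crossings. -/
structure IsColoring (w : List Letter) (u : ℕ → Fin 4 → Q) : Prop where
  join : ∀ l a, w[l]? = some a → ∀ i, i ≠ a.underPos → u (l + 1) (a.perm i) = u l i
  crossing : ∀ l a, w[l]? = some a →
    if a.2 = true ↔ Rightward w l a.overPos then
      u (l + 1) a.overPos = (1 - meridianAt w l a.underPos : Laurent2) • u l a.overPos +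
        (meridianAt w l a.overPos : Laurent2) • u l a.underPos
    else
      u l a.underPos = (1 - meridianAt w l a.underPos : Laurent2) • u l a.overPos +
        (meridianAt w l a.overPos : Laurent2) • u (l + 1) a.overPos

/-- Each level determines the next: a crossing relation can be solved for the new piece, as its
coefficient is `1` or a meridian, hence a unit. -/
theorem IsColoring.eq_zero {w : List Letter} {u : ℕ → Fin 4 → Q} (hu : IsColoring w u)
    (h0 : ∀ i, u 0 i = 0) : ∀ l ≤ w.length, ∀ i, u l i = 0 := by
  intro l
  induction l with
  | zero => exact fun _ => h0
  | succ l ih =>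
    intro hl i
    have ha : w[l]? = some w[l] := List.getElem?_eq_getElem hl
    generalize w[l] = a at ha
    have ih := ih (Nat.le_of_succ_le hl)
    by_cases hi : a.perm i = a.underPos
    · have hi' : i = a.overPos := a.perm.injective (hi.trans a.perm_overPos.symm)
      have hc := hu.crossing l a ha
      rw [hi']
      split_ifs at hc
      · rw [hc, ih, ih, smul_zero, smul_zero, add_zero]
      · rw [ih, ih, smul_zero, zero_add] at hc
        have := congrArg (fun z => (meridianAt w l a.overPos)⁻¹ • z) hc
        simpa [← Units.smul_def] using this.symm
    · have := hu.join l a ha _ hi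
      rwa [ih, show a.perm (a.perm i) = i by simp [Letter.perm]] at this

/-- The effect of the part of the braid between the levels `l` and `l'` on a colouring, in terms of
the coordinates `u₀ - u₁` and `(y - 1) u₁ - (x - 1) u₂`. -/
structure Transforms (u : ℕ → Fin 4 → Q) (l l' : ℕ) (M : Matrix (Fin 2) (Fin 2) Laurent2) :
    Prop where
  sum_eq : u l' 0 - u l' 1 + u l' 2 - u l' 3 = u l 0 - u l 1 + u l 2 - u l 3
  fst_eq : u l' 0 - u l' 1 =
    M 0 0 • (u l 0 - u l 1) + M 0 1 • ((Y - 1) • u l 1 - (X - 1) • u l 2)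
  snd_eq : (Y - 1) • u l' 1 - (X - 1) • u l' 2 =
    M 1 0 • (u l 0 - u l 1) + M 1 1 • ((Y - 1) • u l 1 - (X - 1) • u l 2)

theorem Transforms.refl (u : ℕ → Fin 4 → Q) (l : ℕ) : Transforms u l l 1 := by
  constructor <;> simp

theorem Transforms.trans {u : ℕ → Fin 4 → Q} {l l' l'' : ℕ}
    {M N : Matrix (Fin 2) (Fin 2) Laurent2} (h : Transforms u l l' M)
    (h' : Transforms u l' l'' N) : Transforms u l l'' (N * M) where
  sum_eq := h'.sum_eq.trans h.sum_eq
  fst_eq := by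
    rw [h'.fst_eq, h.fst_eq, h.snd_eq]
    simp only [Matrix.mul_apply, Fin.sum_univ_two]
    module
  snd_eq := by
    rw [h'.snd_eq, h.fst_eq, h.snd_eq]
    simp only [Matrix.mul_apply, Fin.sum_univ_two]
    module

/-- The inverse of the variable `x`. -/
def Xinv : Laurent2 := ↑(meridian 0)⁻¹

/-- The inverse of the variable `y`. -/
def Yinv : Laurent2 := ↑(meridian 1)⁻¹

theorem X_mul_Xinv : X * Xinv = 1 := (meridian 0).mul_inv

theorem Y_mul_Yinv : Y * Yinv = 1 := (meridian 1).mul_inv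

/-- The matrix of a right-handed full twist of the two middle strings (`true`) or of the two upper
strings (`false`). -/
def twistMatrix : Bool → (Matrix (Fin 2) (Fin 2) Laurent2)ˣ
  | true =>
    { val := !![1, -Xinv; 0, Xinv * Y]
      inv := !![1, Yinv; 0, X * Yinv]
      val_inv := by
        have h1 := X_mul_Xinv
        have h2 := Y_mul_Yinv
        refine Matrix.ext fun i j => ?_
        fin_cases i <;> fin_cases j <;> simp [Matrix.mul_apply, Fin.sum_univ_two]
        · linear_combination -Yinv * h1
        · linear_combination h1 * Y * Yinv + h2
      inv_val := by
        have h1 := X_mul_Xinv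
        have h2 := Y_mul_Yinv
        refine Matrix.ext fun i j => ?_
        fin_cases i <;> fin_cases j <;> simp [Matrix.mul_apply, Fin.sum_univ_two]
        · linear_combination Xinv * h2
        · linear_combination h1 * Y * Yinv + h2 }
  | false =>
    { val := !![1, 0; -((X - 1) * (Y - 1)), 1]
      inv := !![1, 0; (X - 1) * (Y - 1), 1]
      val_inv := by
        refine Matrix.ext fun i j => ?_
        fin_cases i <;> fin_cases j <;> simp [Matrix.mul_apply, Fin.sum_univ_two]
      inv_val := by
        refine Matrix.ext fun i j => ?_
        fin_cases i <;> fin_cases j <;> simp [Matrix.mul_apply, Fin.sum_univ_two] }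

/-- The letter of a half twist of the two middle strings or of the two upper strings. -/
def twistLetter (middle b : Bool) : Letter := (if middle then 1 else 0, b)

theorem meridianAt_of_origin {w : List Letter} {l : ℕ} {σ : Equiv.Perm (Fin 4)}
    (h : origin w l = σ) (i : Fin 4) :
    meridianAt w l i = meridian (if (σ i : ℕ) < 2 then 0 else 1) := by
  rw [meridianAt, h]

theorem rightward_of_origin {w : List Letter} {l : ℕ} {σ : Equiv.Perm (Fin 4)}
    (h : origin w l = σ) (i : Fin 4) : Rightward w l i ↔ (σ i = 0 ∨ σ i = 2) := by
  rw [Rightward, h]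

theorem IsColoring.crossing_of_origin {w : List Letter} {u : ℕ → Fin 4 → Q} (hu : IsColoring w u)
    {l : ℕ} {a : Letter} {σ : Equiv.Perm (Fin 4)} (h : origin w l = σ) (ha : w[l]? = some a) :
    if a.2 = true ↔ (σ a.overPos = 0 ∨ σ a.overPos = 2) then
      u (l + 1) a.overPos =
        (1 - meridian (if (σ a.underPos : ℕ) < 2 then 0 else 1) : Laurent2) • u l a.overPos +
        (meridian (if (σ a.overPos : ℕ) < 2 then 0 else 1) : Laurent2) • u l a.underPos
    else
      u l a.underPos =
        (1 - meridian (if (σ a.underPos : ℕ) < 2 then 0 else 1) : Laurent2) • u l a.overPos +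
        (meridian (if (σ a.overPos : ℕ) < 2 then 0 else 1) : Laurent2) • u (l + 1) a.overPos := by
  have := hu.crossing l a ha
  simpa only [rightward_of_origin h, meridianAt_of_origin h] using this

theorem eq_of_unit_smul_eq (t : Laurent2ˣ) {a b : Q}
    (h : (t : Laurent2) • a = (t : Laurent2) • b) : a = b := by
  rw [← Units.smul_def, ← Units.smul_def] at h
  exact smul_left_cancel t h

/-- The two strings of a twist run in opposite directions, so of its two crossing relations one
gives the new piece explicitly and the other only after cancelling a meridian. -/
theorem IsColoring.full_twist {w : List Letter} {u : ℕ → Fin 4 → Q} (hu : IsColoring w u)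
    {l : ℕ} {m b : Bool} (h0 : w[l]? = some (twistLetter m b))
    (h1 : w[l + 1]? = some (twistLetter m b)) (hl : origin w l = 1) :
    origin w (l + 2) = 1 ∧
      Transforms u l (l + 2) ((if b then twistMatrix m else (twistMatrix m)⁻¹ :) : Matrix _ _ _) := by
  have hl1 : origin w (l + 1) = (twistLetter m b).perm := by rw [origin_succ h0, hl, one_mul]
  have hl2 : origin w (l + 2) = 1 := by
    rw [origin_succ h1, hl1]; simp [Letter.perm]
  refine ⟨hl2, ?_⟩
  have j0 := hu.join l _ h0
  have j1 := hu.join (l + 1) _ h1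
  have c0 := hu.crossing_of_origin hl h0
  have c1 := hu.crossing_of_origin hl1 h1
  have hX := X_mul_Xinv
  have hY := Y_mul_Yinv
  have hmx : (meridian 0 : Laurent2) = X := rfl
  have hmy : (meridian 1 : Laurent2) = Y := rfl
  -- A full twist of the upper strings translates both by a multiple of `u₀ - u₁`; one of the middle
  -- strings translates both by a multiple of `δ`.
  cases m <;> cases b <;> simp [twistLetter, Letter.overPos, Letter.underPos, Letter.perm,
    Letter.top, Letter.bot, Equiv.swap_apply_def, Fin.forall_fin_succ, hmx, hmy] at j0 j1 c0 c1 <;>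
    obtain ⟨p0, p1, p2⟩ := j0 <;> obtain ⟨q0, q1, q2⟩ := j1
  · have e0 : u (l + 2) 0 = u l 0 + (X - 1) • (u l 0 - u l 1) := by
      rw [q0, c0]; module
    have e1 : u (l + 2) 1 = u l 1 + (X - 1) • (u l 0 - u l 1) := by
      refine eq_of_unit_smul_eq (meridian 0) ?_
      rw [hmx]
      linear_combination (norm := module) -c1 + p0 - (1 - X) • c0
    have e2 : u (l + 2) 2 = u l 2 := q1.trans p1
    have e3 : u (l + 2) 3 = u l 3 := q2.trans p2
    constructor <;> simp [twistMatrix, e0, e1, e2, e3] <;> module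
  · have e0 : u (l + 2) 0 = u l 0 - (X - 1) • (u l 0 - u l 1) := by
      refine eq_of_unit_smul_eq (meridian 0) ?_
      rw [hmx]
      linear_combination (norm := module) -c1 + p0 - (1 - X) • c0
    have e1 : u (l + 2) 1 = u l 1 - (X - 1) • (u l 0 - u l 1) := by
      rw [q0, c0]; module
    have e2 : u (l + 2) 2 = u l 2 := q1.trans p1
    have e3 : u (l + 2) 3 = u l 3 := q2.trans p2
    constructor <;> simp [twistMatrix, e0, e1, e2, e3] <;> module
  · have v : u (l + 1) 2 = u l 1 - Yinv • ((Y - 1) • u l 1 - (X - 1) • u l 2) := by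
      refine eq_of_unit_smul_eq (meridian 1) ?_
      rw [hmy]
      linear_combination (norm := module) -c0 + hY • ((Y - 1) • u l 1 - (X - 1) • u l 2)
    have e0 : u (l + 2) 0 = u l 0 := q0.trans p0
    have e1 : u (l + 2) 1 = u l 1 - Yinv • ((Y - 1) • u l 1 - (X - 1) • u l 2) := q1.trans v
    have e2 : u (l + 2) 2 = u l 2 - Yinv • ((Y - 1) • u l 1 - (X - 1) • u l 2) := by
      rw [c1, v, p1]
      linear_combination (norm := module) hY • ((Y - 1) • u l 1 - (X - 1) • u l 2)
    have e3 : u (l + 2) 3 = u l 3 := q2.trans p2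
    constructor <;> simp [twistMatrix, e0, e1, e2, e3]
    · module
    · module
    · linear_combination (norm := module) -hY • ((Y - 1) • u l 1 - (X - 1) • u l 2)
  · have v : u (l + 1) 1 = u l 2 + Xinv • ((Y - 1) • u l 1 - (X - 1) • u l 2) := by
      refine eq_of_unit_smul_eq (meridian 0) ?_
      rw [hmx]
      linear_combination (norm := module) -c0 - hX • ((Y - 1) • u l 1 - (X - 1) • u l 2)
    have e0 : u (l + 2) 0 = u l 0 := q0.trans p0
    have e1 : u (l + 2) 1 = u l 1 + Xinv • ((Y - 1) • u l 1 - (X - 1) • u l 2) := by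
      rw [c1, v, p1]
      linear_combination (norm := module) -hX • ((Y - 1) • u l 1 - (X - 1) • u l 2)
    have e2 : u (l + 2) 2 = u l 2 + Xinv • ((Y - 1) • u l 1 - (X - 1) • u l 2) := q1.trans v
    have e3 : u (l + 2) 3 = u l 3 := q2.trans p2
    constructor <;> simp [twistMatrix, e0, e1, e2, e3]
    · module
    · module
    · linear_combination (norm := module) -hX • ((Y - 1) • u l 1 - (X - 1) • u l 2)

theorem IsColoring.replicate_twist {w : List Letter} {u : ℕ → Fin 4 → Q} (hu : IsColoring w u)
    {m b : Bool} (n : ℕ) : ∀ {l : ℕ}, (∀ j < 2 * n, w[l + j]? = some (twistLetter m b)) →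
    origin w l = 1 → origin w (l + 2 * n) = 1 ∧ Transforms u l (l + 2 * n)
      (((if b then twistMatrix m else (twistMatrix m)⁻¹) ^ n :) : Matrix _ _ _) := by
  induction n with
  | zero =>
    intro l _ h
    exact ⟨h, by simpa using Transforms.refl u l⟩
  | succ n ih =>
    intro l hw hl
    obtain ⟨h1, h2⟩ := hu.full_twist (hw 0 (by omega)) (hw 1 (by omega)) hl
    obtain ⟨h3, h4⟩ := ih (l := l + 2)
      (fun j hj => by rw [add_assoc]; exact hw _ (by omega)) h1
    have : l + 2 * (n + 1) = l + 2 + 2 * n := by ring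
    rw [this]
    refine ⟨h3, ?_⟩
    rw [pow_succ, Units.val_mul]
    exact h2.trans h4

/-- The matrix of the braid of a sequence of even numbers of half twists. -/
def braidMatrix : Bool → List ℤ → (Matrix (Fin 2) (Fin 2) Laurent2)ˣ
  | _, [] => 1
  | m, c :: cs => braidMatrix (!m) cs * twistMatrix m ^ (c / 2)

/-- The offset `l` lets the induction consume the sequence while the ambient word `w` stays fixed.
Evenness ensures that each block consists of full twists. -/
theorem IsColoring.transforms_twistWord {w : List Letter} {u : ℕ → Fin 4 → Q}
    (hu : IsColoring w u) (c : List ℤ) : ∀ (m : Bool) (l : ℕ), (∀ z ∈ c, Even z) →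
    (∀ j < (twistWord m c).length, w[l + j]? = (twistWord m c)[j]?) → origin w l = 1 →
    origin w (l + (twistWord m c).length) = 1 ∧
      Transforms u l (l + (twistWord m c).length) (braidMatrix m c : Matrix _ _ _) := by
  induction c with
  | nil => exact fun m l _ _ h => ⟨h, Transforms.refl u l⟩
  | cons z c ih =>
    intro m l hc hw hl
    obtain ⟨k, rfl⟩ := (hc z List.mem_cons_self).exists_two_nsmul
    have hz : (2 • k).natAbs = 2 * k.natAbs := by simp [Int.natAbs_mul]
    have hlen : (twistWord m (2 • k :: c)).length =
        2 * k.natAbs + (twistWord (!m) c).length := by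
      rw [twistWord, List.length_append, List.length_replicate, hz]
    rw [hlen] at hw ⊢
    rw [twistWord, hz] at hw
    obtain ⟨h1, h2⟩ := hu.replicate_twist (m := m) (b := decide (0 < 2 • k)) k.natAbs (l := l)
      (fun j hj => by
        rw [hw j (by omega), List.getElem?_append_left (by simpa using hj),
          List.getElem?_replicate_of_lt hj]
        rfl) hl
    obtain ⟨h3, h4⟩ := ih (!m) (l + 2 * k.natAbs) (fun z hz => hc z (List.mem_cons_of_mem _ hz))
      (fun j hj => by
        rw [add_assoc, hw _ (by omega), List.getElem?_append_right (by simp)]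
        simp) h1
    rw [← add_assoc]
    refine ⟨h3, ?_⟩
    -- The case `k = 0` is treated as left-handed, harmlessly, since the block is then empty.
    have hp : twistMatrix m ^ (2 • k / 2) =
        (if decide (0 < 2 • k) then twistMatrix m else (twistMatrix m)⁻¹) ^ k.natAbs := by
      have hk : 2 • k / 2 = k := by simp
      rw [hk]
      rcases lt_or_ge 0 k with h | h
      · simp only [nsmul_eq_mul, Nat.cast_ofNat, Nat.ofNat_pos, mul_pos_iff_of_pos_left,
          h, decide_true, if_true]
        rw [← zpow_natCast, Int.natAbs_of_nonneg h.le]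
      · simp only [nsmul_eq_mul, Nat.cast_ofNat, Nat.ofNat_pos, mul_pos_iff_of_pos_left, h.not_gt,
          decide_false, Bool.false_eq_true, if_false]
        rw [← zpow_natCast, Int.ofNat_natAbs_of_nonpos h, zpow_neg, inv_zpow, inv_inv]
    rw [braidMatrix, Units.val_mul, hp]
    exact h2.trans h4

end Coloring

/-! ### The Alexander polynomial of a 2-bridge link -/

section Diagram

open FreeGroup (of)

/-- The meridian, in the group ring of the first homology, of a piece of a plat diagram. -/
def pieceMeridian (w : List Letter) (e : Piece w) : Laurent2ˣ :=
  meridian ((platDiagram w).component e)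

/-- The Wirtinger relators at the crossings of a plat diagram. -/
def crossingRelator (w : List Letter) (k : Fin w.length × Fin 4) : FreeGroup (Piece w) :=
  if k.2 = (w.get k.1).underPos then
    of (crossingAt w k.1).overPiece * of (crossingAt w k.1).rightPiece *
      (of (crossingAt w k.1).overPiece)⁻¹ * (of (crossingAt w k.1).leftPiece)⁻¹
  else of ((k.1.castSucc, k.2) : Piece w) * (of ((k.1.succ, (w.get k.1).perm k.2) : Piece w))⁻¹

/-- The relators of a plat diagram at the crossings and at the left end. -/
def openRelator (w : List Letter) : (Fin w.length × Fin 4) ⊕ Bool → FreeGroup (Piece w)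
  | Sum.inl k => crossingRelator w k
  | Sum.inr true => of ((0, 0) : Piece w) * (of ((0, 1) : Piece w))⁻¹
  | Sum.inr false => of ((0, 2) : Piece w) * (of ((0, 3) : Piece w))⁻¹

/-- The images of the basis vectors under a linear map, indexed by natural numbers. -/
def pieceImage {w : List Letter} {Q : Type} [AddCommGroup Q] [Module Laurent2 Q]
    (φ : (Piece w → Laurent2) →ₗ[Laurent2] Q) (l : ℕ) (i : Fin 4) : Q :=
  if hl : l < w.length + 1 then φ (Pi.single (⟨l, hl⟩, i) 1) else 0

variable {w : List Letter} {Q : Type} [AddCommGroup Q] [Module Laurent2 Q]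

theorem pieceImage_val (φ : (Piece w → Laurent2) →ₗ[Laurent2] Q) (l : Fin (w.length + 1))
    (i : Fin 4) : pieceImage φ l i = φ (Pi.single (l, i) 1) := by
  rw [pieceImage, dif_pos l.2]

theorem pieceMeridian_mk (l : Fin (w.length + 1)) (i : Fin 4) :
    pieceMeridian w (l, i) = meridianAt w l i := rfl

/-- The colouring conditions are the images under `φ` of the Fox derivatives. They involve only
levels up to `w.length`, so the default value `0` beyond is never tested. -/
theorem isColoring_pieceImage (φ : (Piece w → Laurent2) →ₗ[Laurent2] Q)
    (hφ : ∀ k, φ (foxDeriv (pieceMeridian w) (crossingRelator w k)) = 0) :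
    IsColoring w (pieceImage φ) := by
  constructor
  · intro l a ha i hi
    obtain ⟨hl, rfl⟩ := List.getElem?_eq_some_iff.1 ha
    have h := hφ (⟨l, hl⟩, i)
    have hi' : i ≠ (w.get ⟨l, hl⟩).underPos := hi
    have hm : pieceMeridian w ((⟨l, hl⟩ : Fin w.length).castSucc, i) =
        pieceMeridian w ((⟨l, hl⟩ : Fin w.length).succ, (w.get ⟨l, hl⟩).perm i) :=
      (meridianAt_perm ha i).symm
    simp only [crossingRelator, if_neg hi', foxDeriv_join _ hm, map_sub] at h
    rw [← pieceImage_val, ← pieceImage_val] at h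
    exact (sub_eq_zero.1 h).symm
  · intro l a ha
    obtain ⟨hl, rfl⟩ := List.getElem?_eq_some_iff.1 ha
    have h := hφ (⟨l, hl⟩, (w.get ⟨l, hl⟩).underPos)
    have hm : pieceMeridian w ((⟨l, hl⟩ : Fin w.length).succ, (w.get ⟨l, hl⟩).overPos) =
        pieceMeridian w ((⟨l, hl⟩ : Fin w.length).castSucc, (w.get ⟨l, hl⟩).underPos) :=
      meridianAt_overPos ha
    simp only [crossingRelator, if_true, crossingAt] at h
    change if (w.get ⟨l, hl⟩).2 = true ↔ Rightward w l (w.get ⟨l, hl⟩).overPos then _ else _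
    split_ifs at h ⊢ with hif
    · rw [foxDeriv_conj _ hm.symm] at h
      simp only [map_sub, map_add, map_smul, ← pieceImage_val, pieceMeridian_mk] at h
      exact (sub_eq_zero.1 h).symm
    · rw [foxDeriv_conj _ hm] at h
      simp only [map_sub, map_add, map_smul, ← pieceImage_val, hm] at h
      exact (sub_eq_zero.1 h).symm

theorem openRelator_mem (k : (Fin w.length × Fin 4) ⊕ Bool) :
    openRelator w k ∈ (platDiagram w).wirtinger := by
  rcases k with ⟨l, i⟩ | b
  · by_cases hi : i = (w.get l).underPos
    · exact Or.inl ⟨_, ⟨l, rfl⟩, by simp only [openRelator, crossingRelator, if_pos hi]⟩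
    · exact Or.inr ⟨_, Or.inl ⟨l, i, hi, rfl⟩,
        by simp only [openRelator, crossingRelator, if_neg hi]⟩
  · cases b
    · exact Or.inr ⟨((0, 2), (0, 3)), Or.inr (by simp), rfl⟩
    · exact Or.inr ⟨((0, 0), (0, 1)), Or.inr (by simp), rfl⟩

theorem eq_openRelator_or_closing {r : FreeGroup (Piece w)}
    (hr : r ∈ (platDiagram w).wirtinger) :
    (∃ k, r = openRelator w k) ∨
      r = of ((Fin.last _, 0) : Piece w) * (of ((Fin.last _, 1) : Piece w))⁻¹ ∨
      r = of ((Fin.last _, 2) : Piece w) * (of ((Fin.last _, 3) : Piece w))⁻¹ := by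
  rcases hr with ⟨_, ⟨l, rfl⟩, rfl⟩ | ⟨p, ⟨l, i, hi, rfl⟩ | hp, rfl⟩
  · exact Or.inl ⟨Sum.inl (l, (w.get l).underPos), by
      simp only [openRelator, crossingRelator, if_true]⟩
  · exact Or.inl ⟨Sum.inl (l, i), by simp only [openRelator, crossingRelator, if_neg hi]⟩
  · simp only [Set.mem_insert_iff, Set.mem_singleton_iff] at hp
    rcases hp with rfl | rfl | rfl | rfl
    · exact Or.inl ⟨Sum.inr true, rfl⟩
    · exact Or.inl ⟨Sum.inr false, rfl⟩
    · exact Or.inr (Or.inl rfl)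
    · exact Or.inr (Or.inr rfl)

theorem pieceMeridian_eq_of_origin {l : Fin (w.length + 1)} (h : origin w l = 1) :
    pieceMeridian w (l, 0) = pieceMeridian w (l, 1) ∧
      pieceMeridian w (l, 2) = pieceMeridian w (l, 3) := by
  simp only [pieceMeridian_mk, meridianAt_of_origin h]
  simp

/-- The hypothesis `hM` ranges over all modules because it is applied to the universal colouring,
with values in the quotient by the open relators. -/
theorem isIdealGCD_platDiagram {M : Matrix (Fin 2) (Fin 2) Laurent2}
    (hw : origin w w.length = 1)
    (hM : ∀ (Q : Type) [AddCommGroup Q] [Module Laurent2 Q] (u : ℕ → Fin 4 → Q),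
      IsColoring w u → Transforms u 0 w.length M) :
    IsIdealGCD (alexanderIdeal (platDiagram w).wirtinger (pieceMeridian w)) (M 0 1) := by
  classical
  obtain ⟨hs1, hs2⟩ := pieceMeridian_eq_of_origin (l := (0 : Fin (w.length + 1))) (origin_zero w)
  obtain ⟨ht1, ht2⟩ := pieceMeridian_eq_of_origin (l := Fin.last w.length) hw
  let g := fun k => foxDeriv (pieceMeridian w) (openRelator w k)
  have hg1 : g (Sum.inr true) = Pi.single (0, 0) 1 - Pi.single (0, 1) 1 := foxDeriv_join _ hs1
  have hg2 : g (Sum.inr false) = Pi.single (0, 2) 1 - Pi.single (0, 3) 1 := foxDeriv_join _ hs2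
  have key : ∀ (S : Submodule Laurent2 (Piece w → Laurent2)), (∀ k, g k ∈ S) →
      IsColoring w (pieceImage S.mkQ) ∧ pieceImage S.mkQ 0 0 = pieceImage S.mkQ 0 1 ∧
        pieceImage S.mkQ 0 2 = pieceImage S.mkQ 0 3 := by
    intro S hS
    have hz : ∀ k, S.mkQ (g k) = 0 := fun k => (Submodule.Quotient.mk_eq_zero S).2 (hS k)
    refine ⟨isColoring_pieceImage _ fun k => hz (Sum.inl k), ?_, ?_⟩
    · have h := hz (Sum.inr true)
      rw [hg1, map_sub, ← pieceImage_val, ← pieceImage_val] at h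
      exact sub_eq_zero.1 h
    · have h := hz (Sum.inr false)
      rw [hg2, map_sub, ← pieceImage_val, ← pieceImage_val] at h
      exact sub_eq_zero.1 h
  obtain ⟨hc, hc1, hc2⟩ := key (Submodule.span Laurent2 (Set.range g))
    fun k => Submodule.subset_span ⟨k, rfl⟩
  have hT := hM _ _ hc
  have hmod : foxDeriv (pieceMeridian w)
      (of ((Fin.last _, 0) : Piece w) * (of ((Fin.last _, 1) : Piece w))⁻¹) -
        M 0 1 • ((Y - 1) • Pi.single ((0, 0) : Piece w) 1 +
          (-(X - 1)) • Pi.single ((0, 2) : Piece w) 1) ∈ Submodule.span Laurent2 (Set.range g) := by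
    rw [foxDeriv_join _ ht1, ← Submodule.Quotient.mk_eq_zero, ← Submodule.mkQ_apply]
    simp only [map_sub, map_add, map_smul, ← pieceImage_val]
    have h := hT.fst_eq
    rw [← hc1, sub_self, smul_zero, zero_add] at h
    rw [sub_eq_zero, neg_smul, ← sub_eq_add_neg]
    exact h
  -- For `N` crossings there are `4 N + 2` open relators and `4 (N + 1)` generators, whence the two
  -- basis elements `(0, 0)` and `(0, 2)`.
  refine isIdealGCD_alexanderIdeal _ _ (openRelator w) (Pi.single (0, 0) 1) (Pi.single (0, 2) 1)
    (of ((Fin.last _, 0) : Piece w) * (of ((Fin.last _, 1) : Piece w))⁻¹)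
    (M 0 1) (Y - 1) (-(X - 1)) (by simp; ring) openRelator_mem ?_ ?_ hmod ?_
    fun e => dvd_of_dvd_mul_sub_one
  · exact Or.inr ⟨((Fin.last _, 0), (Fin.last _, 1)), Or.inr (by simp), rfl⟩
  · rintro ⟨l, i⟩
    -- Killing these two elements as well makes the colouring vanish at level `0`, hence everywhere;
    -- so together with the open relators they span.
    obtain ⟨hd, hd1, hd2⟩ := key (Submodule.span Laurent2 (insert (Pi.single (0, 2) 1)
      (insert (Pi.single (0, 0) 1) (Set.range g))))
      fun k => Submodule.subset_span (Or.inr (Or.inr ⟨k, rfl⟩))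
    have hz0 : pieceImage (Submodule.mkQ (Submodule.span Laurent2 (insert (Pi.single (0, 2) 1)
        (insert (Pi.single (0, 0) 1) (Set.range g))))) 0 0 = 0 := by
      refine (pieceImage_val _ 0 0).trans ((Submodule.Quotient.mk_eq_zero _).2 ?_)
      exact Submodule.subset_span (Or.inr (Or.inl rfl))
    have hz2 : pieceImage (Submodule.mkQ (Submodule.span Laurent2 (insert (Pi.single (0, 2) 1)
        (insert (Pi.single (0, 0) 1) (Set.range g))))) 0 2 = 0 := by
      refine (pieceImage_val _ 0 2).trans ((Submodule.Quotient.mk_eq_zero _).2 ?_)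
      exact Submodule.subset_span (Or.inl rfl)
    have h := hd.eq_zero (by
      rw [Fin.forall_fin_succ, Fin.forall_fin_succ, Fin.forall_fin_succ, Fin.forall_fin_one]
      exact ⟨hz0, hd1 ▸ hz0, hz2, hd2 ▸ hz2⟩) l (Nat.le_of_lt_succ l.2) i
    rw [pieceImage_val] at h
    exact (Submodule.Quotient.mk_eq_zero _).1 h
  · intro r hr
    have hle : Submodule.span Laurent2 (Set.range g) ≤ Submodule.span _
        (insert (M 0 1 • ((Y - 1) • Pi.single ((0, 0) : Piece w) 1 +
          (-(X - 1)) • Pi.single ((0, 2) : Piece w) 1)) (Set.range g)) :=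
      Submodule.span_mono (Set.subset_insert _ _)
    have h1 := Submodule.add_mem _ (hle hmod) (Submodule.subset_span (Set.mem_insert _ _))
    rw [sub_add_cancel] at h1
    rcases eq_openRelator_or_closing hr with ⟨k, rfl⟩ | rfl | rfl
    · exact hle (Submodule.subset_span ⟨k, rfl⟩)
    · exact h1
    -- By invariance of the alternating sum, the second closing relation is the negative of the
    -- first modulo the open relators.
    · have hsum : foxDeriv (pieceMeridian w)
          (of ((Fin.last _, 0) : Piece w) * (of ((Fin.last _, 1) : Piece w))⁻¹) +
        foxDeriv (pieceMeridian w)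
          (of ((Fin.last _, 2) : Piece w) * (of ((Fin.last _, 3) : Piece w))⁻¹) ∈
          Submodule.span Laurent2 (Set.range g) := by
        rw [foxDeriv_join _ ht1, foxDeriv_join _ ht2, ← Submodule.Quotient.mk_eq_zero,
          ← Submodule.mkQ_apply]
        simp only [map_sub, map_add, ← pieceImage_val]
        have h := hT.sum_eq
        rw [hc1, hc2, sub_self, zero_add, sub_self] at h
        rw [← add_sub_assoc]
        exact h
      have := Submodule.sub_mem _ (hle hsum) h1
      rwa [add_sub_cancel_left] at this

theorem associated_Δ (c : List ℤ) (hc : ∀ z ∈ c, Even z) :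
    Associated (Δ c) ((braidMatrix true c : Matrix (Fin 2) (Fin 2) Laurent2) 0 1) := by
  have key := fun (Q : Type) [AddCommGroup Q] [Module Laurent2 Q] (u : ℕ → Fin 4 → Q)
    (hu : IsColoring (twistWord true c) u) =>
      hu.transforms_twistWord c true 0 hc (fun j _ => by rw [zero_add]) (origin_zero _)
  simp only [zero_add] at key
  -- The statement about `origin` does not depend on the colouring, so the zero colouring serves to
  -- extract it.
  have hw : origin (twistWord true c) (twistWord true c).length = 1 :=
    (key Laurent2 (fun _ _ => 0) ⟨by simp, by simp⟩).1
  exact (twoBridge c).isIdealGCD_alexander.associated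
    (isIdealGCD_platDiagram hw fun Q _ _ u hu => (key Q u hu).2)

end Diagram

/-! ### The sequence `[s, 2k, -s⁻¹]` -/

section Palindrome

theorem braidMatrix_append (l₁ l₂ : List ℤ) : ∀ m : Bool, braidMatrix m (l₁ ++ l₂) =
    braidMatrix (m ^^ l₁.length.bodd) l₂ * braidMatrix m l₁ := by
  induction l₁ with
  | nil => simp [braidMatrix]
  | cons c l₁ ih =>
    intro m
    rw [List.cons_append, braidMatrix, braidMatrix, ih, mul_assoc, List.length_cons,
      Nat.bodd_succ]
    congr 2
    cases m <;> simp

/-- The reversed sequence undoes the twists one by one, starting with the kind of twist on which `s`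
ended; this explains the flag `m ^^ !s.length.bodd`. -/
theorem braidMatrix_negInv (s : List ℤ) : ∀ m : Bool, (∀ c ∈ s, Even c) →
    braidMatrix (m ^^ !s.length.bodd) (negInv s) = (braidMatrix m s)⁻¹ := by
  induction s with
  | nil => simp [braidMatrix, negInv]
  | cons c s ih =>
    intro m hs
    have h1 : negInv (c :: s) = negInv s ++ [-c] := by simp [negInv]
    have h2 : (negInv s).length = s.length := by simp [negInv]
    -- Integer division rounds down, so this needs `c` to be even.
    have h3 : (-c) / 2 = -(c / 2) := by
      obtain ⟨k, rfl⟩ := (hs c List.mem_cons_self).exists_two_nsmul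
      simp [← mul_neg]
    have h4 : (m ^^ !(!s.length.bodd)) = (!m ^^ !s.length.bodd) := by
      cases m <;> simp
    have h5 : ((!m ^^ !s.length.bodd) ^^ s.length.bodd) = m := by
      cases m <;> simp
    rw [h1, List.length_cons, Nat.bodd_succ, h4, braidMatrix_append, h2, h5,
      ih _ fun c hc => hs c (List.mem_cons_of_mem _ hc)]
    simp [braidMatrix, h3]

theorem coe_twistMatrix_false_zpow (k : ℤ) :
    ((twistMatrix false ^ k : (Matrix (Fin 2) (Fin 2) Laurent2)ˣ) : Matrix _ _ _) =
      !![1, 0; -(k * ((X - 1) * (Y - 1))), 1] := by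
  have h1 : ((twistMatrix false : (Matrix (Fin 2) (Fin 2) Laurent2)ˣ) : Matrix _ _ _) =
      !![1, 0; -((X - 1) * (Y - 1)), 1] := rfl
  have h2 : (((twistMatrix false)⁻¹ : (Matrix (Fin 2) (Fin 2) Laurent2)ˣ) : Matrix _ _ _) =
      !![1, 0; (X - 1) * (Y - 1), 1] := rfl
  induction k using Int.induction_on with
  | zero => simp [Matrix.one_fin_two]
  | succ n ih =>
    rw [zpow_add_one, Units.val_mul, ih, h1, Matrix.mul_fin_two]
    simp only [mul_one, one_mul, mul_zero, zero_mul, add_zero, zero_add]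
    refine congrArg (fun z : Laurent2 => !![1, 0; z, 1]) ?_
    push_cast
    ring
  | pred n ih =>
    rw [zpow_sub_one, Units.val_mul, ih, h2, Matrix.mul_fin_two]
    simp only [mul_one, one_mul, mul_zero, zero_mul, add_zero, zero_add]
    refine congrArg (fun z : Laurent2 => !![1, 0; z, 1]) ?_
    push_cast
    ring

/-- With `V = M⁻¹`, the entry is `-z * V₀₁ * M₀₁`, because the part without `z` is an off-diagonal
entry of `V * M = 1`. Moreover `det M * V₀₁ = -M₀₁`, so the unit is `det M`. -/
theorem inv_mul_lower_mul_apply {A : Type} [CommRing A] (M : (Matrix (Fin 2) (Fin 2) A)ˣ) (z : A) :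
    Associated ((((M⁻¹ : (Matrix (Fin 2) (Fin 2) A)ˣ) : Matrix (Fin 2) (Fin 2) A) *
      !![1, 0; -z, 1] * (M : Matrix (Fin 2) (Fin 2) A)) 0 1)
      (z * (M : Matrix (Fin 2) (Fin 2) A) 0 1 ^ 2) := by
  have hdet : IsUnit (M : Matrix (Fin 2) (Fin 2) A).det :=
    (Matrix.isUnit_iff_isUnit_det _).1 M.isUnit
  have hVM := M.inv_mul
  generalize ((M⁻¹ : (Matrix (Fin 2) (Fin 2) A)ˣ) : Matrix (Fin 2) (Fin 2) A) = V at *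
  generalize (M : Matrix (Fin 2) (Fin 2) A) = N at *
  have e1 := congrFun (congrFun hVM 0) 0
  have e2 := congrFun (congrFun hVM 0) 1
  simp only [Matrix.mul_apply, Fin.sum_univ_two, Matrix.one_apply_eq] at e1
  simp only [Matrix.mul_apply, Fin.sum_univ_two, Matrix.one_apply_ne zero_ne_one] at e2
  refine ⟨hdet.unit, ?_⟩
  rw [IsUnit.unit_spec, Matrix.det_fin_two]
  simp only [Matrix.mul_apply, Fin.sum_univ_two, Matrix.of_apply, Matrix.cons_val',
    Matrix.cons_val_zero, Matrix.cons_val_one, Matrix.cons_val_fin_one, mul_one, mul_zero, zero_add]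
  linear_combination (N 0 0 * N 1 1 - N 0 1 * N 1 0) * e2 - z * N 0 1 * (N 0 0 * e2 - N 0 1 * e1)

theorem braidMatrix_palindrome (s : List ℤ) (hodd : Odd s.length) (hs : ∀ c ∈ s, Even c) (k : ℤ) :
    braidMatrix true (s ++ [2 * k] ++ negInv s) =
      (braidMatrix true s)⁻¹ * twistMatrix false ^ k * braidMatrix true s := by
  have hb : s.length.bodd = true := by
    obtain ⟨j, hj⟩ := hodd
    rw [hj, Nat.bodd_add, Nat.bodd_mul]
    rfl
  have hk : 2 * k / 2 = k := by simp
  have h := braidMatrix_negInv s true hs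
  rw [hb] at h
  -- As `s` has odd length, the entry `2 * k` twists the upper strings and the reversed part starts
  -- on the middle ones.
  have h' : (true ^^ (s ++ [2 * k]).length.bodd) = (true ^^ !true) := by
    simp [hb]
  rw [braidMatrix_append, h', h, braidMatrix_append, hb, mul_assoc]
  simp [braidMatrix, hk]

end Palindrome

/-! ### Stability -/

section Stability

theorem HStable.of_associated {f g : Laurent2} (h : Associated f g) (hf : HStable f) :
    HStable g := by
  obtain ⟨v, rfl⟩ := h
  refine hf.imp (fun h => by rw [h, zero_mul]) fun h α β hα hβ => ?_
  rw [map_mul]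
  exact mul_ne_zero (h α β hα hβ) (v.isUnit.map (evalAt α β)).ne_zero

theorem evalAt_X (α β : ℂˣ) : evalAt α β X = α := by simp [evalAt, X]

theorem evalAt_Y (α β : ℂˣ) : evalAt α β Y = β := by simp [evalAt, Y]

/-- The factors `x - 1` and `y - 1` vanish only at the real point `1`, and squaring does not change
the zero set. -/
theorem hStable_mul_sq_iff {k : ℤ} (hk : k ≠ 0) (f : Laurent2) :
    HStable ((k : Laurent2) * (X - 1) * (Y - 1) * f ^ 2) ↔ HStable f := by
  have hev : ∀ α β : ℂˣ, evalAt α β ((k : Laurent2) * (X - 1) * (Y - 1) * f ^ 2) =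
      k * (α - 1) * (β - 1) * evalAt α β f ^ 2 := by
    intro α β
    simp [evalAt_X, evalAt_Y]
  have hne : ∀ α : ℂˣ, 0 < (α : ℂ).im → (α : ℂ) - 1 ≠ 0 := by
    intro α hα h
    rw [sub_eq_zero.1 h] at hα
    simp at hα
  have hk' : (k : Laurent2) ≠ 0 := by
    intro h
    have := congrArg (evalAt 1 1) h
    rw [map_intCast, map_zero] at this
    exact hk (by exact_mod_cast this)
  refine or_congr ?_ ?_
  · simp [hk', X_sub_one_ne_zero, Y_sub_one_ne_zero]
  · refine forall_congr' fun α => forall_congr' fun β => forall_congr' fun hα =>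
      forall_congr' fun hβ => ?_
    rw [hev]
    simp [hk, hne α hα, hne β hβ]

end Stability

end TwoBridge

end

open TwoBridge in
theorem theorem16p9 (s : List ℤ) (hodd : Odd s.length) (hs : ∀ c ∈ s, Even c ∧ c ≠ 0)
    (k : ℤ) (hk : k ≠ 0) :
    Associated (Δ (s ++ [2 * k] ++ negInv s)) ((k : Laurent2) * (X - 1) * (Y - 1) * Δ s ^ 2) ∧
      (HStable (Δ (s ++ [2 * k] ++ negInv s)) ↔ HStable (Δ s)) := by
  have hs' : ∀ c ∈ s, Even c := fun c hc => (hs c hc).1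
  have hr : ∀ c ∈ s ++ [2 * k] ++ negInv s, Even c := by
    intro c hc
    simp only [negInv, List.mem_append, List.mem_singleton, List.mem_reverse, List.mem_map] at hc
    rcases hc with (hc | rfl) | ⟨d, hd, rfl⟩
    · exact hs' c hc
    · exact even_two_mul k
    · exact (hs' d hd).neg
  have h : Associated (Δ (s ++ [2 * k] ++ negInv s))
      ((k : Laurent2) * (X - 1) * (Y - 1) * Δ s ^ 2) := by
    refine (associated_Δ _ hr).trans ?_
    rw [braidMatrix_palindrome s hodd hs', Units.val_mul, Units.val_mul,
      coe_twistMatrix_false_zpow]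
    refine (inv_mul_lower_mul_apply _ _).trans ?_
    rw [← mul_assoc (k : Laurent2)]
    exact (associated_Δ s hs').symm.pow_pow.mul_left _
  refine ⟨h, ?_⟩
  rw [← hStable_mul_sq_iff hk (Δ s)]
  exact ⟨HStable.of_associated h, HStable.of_associated h.symm⟩
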